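/- Let $N\ge 0$, let $(\beta_{\mu,\nu})$, $\mu\in\mathbb R^N$, $\nu$ in a non-empty parameter set, be probability densities on $\mathbb R^N$ with $\beta_{\mu,\nu}(\theta)=\beta_{0,\nu}(\theta-\mu)$ for all $\mu,\nu,\theta$ (a translation-invariant family). Assume that for every $\nu$ the density $\beta_{0,\nu}$ is a Schwartz function with finite entropy $\mathrm{Ent}(\beta_{0,\nu})=-\int\beta_{0,\nu}\ln\beta_{0,\nu}$ and that its Fourier transform vanishes nowhere. For every $\nu$ let $r_\nu:\mathbb R^N\to\mathbb R$ be a continuous function which defines a tempered distribution whose Fourier transform $\mathcal F r_\nu$ has compact support. With $\check\beta_{0,\nu}(\theta)=\beta_{0,\nu}(-\theta)$, define the tempered distribution $$A_\nu=-\mathrm{Ent}(\beta_{0,\nu})\,\mathbb 1-\mathcal F^{-1}\!\left[\frac{\mathcal F r_\nu}{\mathcal F\check\beta_{0,\nu}}\right].$$ For a function $\alpha$ on $\mathbb R^N$ the following are equivalent: (1) $\alpha$ is a probability density which is log-tempered (that is, $\alpha>0$ almost everywhere and $\ln\alpha$ is a locally integrable function which defines a tempered distribution), and there is $K\in\mathbb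 R$ such that $r_\nu(\mu)=\mathrm{KL}(\beta_{\mu,\nu}\,\|\,\alpha)+K$ for all $(\mu,\nu)$ (in particular all these divergences are finite), where $\mathrm{KL}(\beta\|\alpha)=\int\ln(\beta/\alpha)\,\beta$; (2) $A_\nu=A$ does not depend on $\nu$, $A$ is (given by) a locally integrable real function with $\int\exp(A)<\infty$ (Condition (C)), and $\alpha=\frac1\kappa\exp(A)$ almost everywhere, where $\kappa=\int\exp(A)$. In particular a log-tempered solution $\alpha$, if one exists, is unique up to equality almost everywhere. -/

import Mathlib

open scoped SchwartzMap FourierTransform ContDiff Topology ENNReal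

namespace PenaltyPrior

open MeasureTheory Distribution

/-- The parameter space `ℝ^N` with its Euclidean structure and Lebesgue measure. -/
abbrev Sp (N : ℕ) : Type := EuclideanSpace ℝ (Fin N)

variable {N : ℕ}

/-! ### Probability densities, entropy, Kullback-Leibler divergence -/

/-- `p` is a probability density with respect to Lebesgue measure. -/
def IsProbDensity (p : Sp N → ℝ) : Prop :=
  Integrable p ∧ (∀ᵐ x, 0 ≤ p x) ∧ ∫ x, p x = 1

/-- The probability measure `p(x) dx`. -/
noncomputable def densityMeasure (p : Sp N → ℝ) : Measure (Sp N) :=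
  volume.withDensity fun x => ENNReal.ofReal (p x)

/-- The Kullback-Leibler divergence `∫ log (p / q) p` of two densities, in `[0, ∞]`. -/
noncomputable def KL (p q : Sp N → ℝ) : ℝ≥0∞ :=
  InformationTheory.klDiv (densityMeasure p) (densityMeasure q)

/-- The differential entropy is finite: `p log p` is integrable (`0 log 0 = 0`). -/
def FiniteEntropy (p : Sp N → ℝ) : Prop :=
  Integrable fun x => Real.negMulLog (p x)

/-- The differential entropy `- ∫ p log p`. -/
noncomputable def Ent (p : Sp N → ℝ) : ℝ :=
  ∫ x, Real.negMulLog (p x)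

/-! ### Tempered distributions -/

/-- The tempered distribution `T` is (the distribution defined by) the locally integrable
function `f`: `⟨T, φ⟩ = ∫ f φ` for every smooth compactly supported test function `φ`. -/
def IsGivenBy (T : 𝓢'(Sp N, ℂ)) (f : Sp N → ℝ) : Prop :=
  LocallyIntegrable f ∧
    ∀ φ : 𝓢(Sp N, ℂ), HasCompactSupport φ → T φ = ∫ x, φ x * (f x : ℂ)

/-- The logarithm of the density `α` is a tempered distribution. In particular `α > 0` almost
everywhere, so that `log α` is a (finite) function. -/
def LogTempered (α : Sp N → ℝ) : Prop :=
  (∀ᵐ x, 0 < α x) ∧ ∃ T : 𝓢'(Sp N, ℂ), IsGivenBy T fun x => Real.log (α x)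

/-- `χ` is a smooth compactly supported function equal to `1` near the support of `S`. -/
def IsCutoff (S : 𝓢'(Sp N, ℂ)) (χ : Sp N → ℂ) : Prop :=
  ContDiff ℝ ∞ χ ∧ HasCompactSupport χ ∧ ∀ᶠ x in 𝓝ˢ (dsupport S), χ x = 1

/-- A compactly supported distribution has a cutoff function. -/
theorem exists_isCutoff (S : 𝓢'(Sp N, ℂ)) (hS : IsCompact (dsupport S)) :
    ∃ χ : Sp N → ℂ, IsCutoff S χ := by
  obtain ⟨M, hM⟩ := hS.isBounded.subset_closedBall (0 : Sp N)
  have hpos : 0 < max M 0 + 1 := by positivity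
  have hlt : max M 0 + 1 < max M 0 + 2 := by linarith
  obtain ⟨f, hf⟩ : ∃ f : ContDiffBump (0 : Sp N), f.rIn = max M 0 + 1 :=
    ⟨⟨max M 0 + 1, max M 0 + 2, hpos, hlt⟩, rfl⟩
  have h1 : ContDiff ℝ ∞ fun x => (f x : ℂ) := Complex.ofRealCLM.contDiff.comp f.contDiff
  have h2 : HasCompactSupport fun x => (f x : ℂ) :=
    f.hasCompactSupport.comp_left (g := fun t : ℝ => (t : ℂ)) Complex.ofReal_zero
  refine ⟨fun x => (f x : ℂ), h1, h2, ?_⟩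
  refine eventually_nhdsSet_iff_exists.2
    ⟨Metric.ball 0 (max M 0 + 1), Metric.isOpen_ball, ?_, ?_⟩
  · intro x hx
    have hxM := hM hx
    rw [Metric.mem_closedBall] at hxM
    rw [Metric.mem_ball]
    linarith [le_max_left M 0]
  · intro x hx
    have h1 : f x = 1 := f.one_of_mem_closedBall (hf ▸ Metric.ball_subset_closedBall hx)
    simp [h1]

open Classical in
/-- The product `S / g` of a compactly supported distribution `S` with the smooth function `1 / g`,
for a smooth nowhere vanishing `g`: `⟨S / g, φ⟩ = ⟨S, χ φ / g⟩`, where `χ` is any cutoff function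
of `S`. (Junk value `0` if `S` has no cutoff function, i.e. is not compactly supported.) -/
noncomputable def quotient (S : 𝓢'(Sp N, ℂ)) (g : Sp N → ℂ) : 𝓢'(Sp N, ℂ) :=
  if h : ∃ χ : Sp N → ℂ, IsCutoff S χ then
    TemperedDistribution.smulLeftCLM ℂ (fun ξ => h.choose ξ / g ξ) S
  else 0

/-! ### The distribution attached to a penalty -/

/-- `- Ent(b) 𝟙 - 𝓕⁻¹ [𝓕 R / 𝓕 b̌]` where `b̌ x = b (-x)`, for a density `b` and a
tempered distribution `R`. (The expression does not depend on the normalization of the Fourier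
transform.) -/
noncomputable def logPrior (b : Sp N → ℝ) (R : 𝓢'(Sp N, ℂ)) : 𝓢'(Sp N, ℂ) :=
  -((Ent b : ℂ) • (volume : Measure (Sp N)).toTemperedDistribution)
    - 𝓕⁻ (quotient (𝓕 R) (𝓕 fun x => (b (-x) : ℂ)))

/-- The family `A ν` of distributions does not depend on `ν`, its common value is the function
`a`, and `exp a` is integrable. -/
def ConditionC {ι : Type*} (A : ι → 𝓢'(Sp N, ℂ)) (a : Sp N → ℝ) : Prop :=
  ∃ T : 𝓢'(Sp N, ℂ), (∀ ν, A ν = T) ∧ IsGivenBy T a ∧ Integrable fun x => Real.exp (a x)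

/-- The family of densities is translation-invariant: `β_{μ,ν}(θ) = β_{0,ν}(θ - μ)`. -/
def TranslationInvariant {ι : Type*} (β : Sp N → ι → Sp N → ℝ) : Prop :=
  ∀ μ ν θ, β μ ν θ = β 0 ν (θ - μ)

/-- `r_ν(μ) = KL(β_{μ,ν} ‖ α) + K` for all `(μ, ν)`, for some real constant `K`; in particular
all these divergences are finite. -/
def IsSolution {ι : Type*} (β : Sp N → ι → Sp N → ℝ) (r : Sp N → ι → ℝ) (α : Sp N → ℝ) : Prop :=
  ∃ K : ℝ, ∀ μ ν, (r μ ν : EReal) = (KL (β μ ν) α : EReal) + (K : EReal)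

end PenaltyPrior

/-!
The proof compares the penalty with the logarithm `a` of the unnormalized prior.

For densities `b` and `α` with `b log b` and `b log α` integrable, the divergence is
`KL(b ‖ α) = - Ent b - ∫ b log α` (`KL_eq`). Writing `log α = a + K`, the requirement
`r(μ) = KL(b(· - μ) ‖ α) + K` becomes the convolution equation
`r(μ) = - Ent b - ∫ b(x - μ) a(x) dx` (`eq_KL_add_iff`). On the Fourier side a convolution is a
product, and since `𝓕 b̌` has no zeros the equation can be solved for `a` by division: it is
equivalent to `logPrior b R = T`, where `T` is the tempered distribution given by `a`
(`logPrior_eq_iff_integral`). Both directions of the theorem follow, with `a = log α - K` in one of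
them and `K = - log ∫ exp a` in the other.

Two points need care.

* A function which defines a tempered distribution need not be integrable against Schwartz
  functions, because the definition only refers to compactly supported test functions. Here
  `exp a` is integrable, so `a⁺` is integrable against every Schwartz function `p ≥ 0`; the
  truncated integrals of `p a` converge to the value of the distribution, so `a⁻` is integrable
  against `p` too (`integrable_mul_of_nonneg`). In particular all the divergences are finite, and
  Fubini's theorem applies to the convolution (`apply_convolve`). Conversely the distributional
  equation yields the pointwise one at every `μ`, as both sides are continuous.
* The quotient `S / g` of a compactly supported distribution is defined through a cutoff function.
  It is the only distribution `W` with `S = g W` (`quotient_eq_iff`), because `S` annihilates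
  the test functions supported away from its support (`apply_eq_zero_of_tsupport_subset`), and
  because compactly supported functions are dense in the Schwartz space (`tendsto_truncate`).
-/

namespace PenaltyPrior

open MeasureTheory Distribution

/-! ### Approximation and translation of Schwartz functions -/

section Schwartz

open Filter SchwartzMap

variable {E F : Type*} [NormedAddCommGroup E] [InnerProductSpace ℝ E]
  [NormedAddCommGroup F] [NormedSpace ℝ F]

/-- Translations act continuously on a Schwartz function. -/
theorem continuous_compSubConst (f : 𝓢(E, F)) :
    Continuous fun a : E => compSubConstCLM ℝ a f := by
  have h0 : ∀ f : 𝓢(E, F), Tendsto (fun a : E => compSubConstCLM ℝ a f) (𝓝 0) (𝓝 f) := by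
    intro f
    rw [(schwartz_withSeminorms ℝ E F).tendsto_nhds]
    rintro ⟨k, m⟩ ε hε
    set C : ℝ := 2 ^ k * ((Finset.Iic (k, m + 1)).sup
      fun m => SchwartzMap.seminorm ℝ m.1 m.2) f with hC
    have hC0 : 0 ≤ C := by positivity
    have key : ∀ a : E, ‖a‖ < 1 →
        SchwartzMap.seminorm ℝ k m (compSubConstCLM ℝ a f - f) ≤ C * ‖a‖ := by
      intro a ha
      refine seminorm_le_bound ℝ k m _ (by positivity) fun x => ?_
      have hcoe : ((compSubConstCLM ℝ a f - f : 𝓢(E, F)) : E → F)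
          = (fun y => f (y - a)) - f := by
        ext y; simp
      have hs : ContDiff ℝ m fun y => f (y - a) :=
        (f.smooth m).comp (contDiff_id.sub contDiff_const)
      rw [hcoe, iteratedFDeriv_sub_apply hs.contDiffAt (f.contDiffAt m), iteratedFDeriv_comp_sub]
      have hd : Differentiable ℝ (iteratedFDeriv ℝ m f) :=
        (f.smooth ⊤).differentiable_iteratedFDeriv (by exact_mod_cast ENat.natCast_lt_top m)
      -- the mean value inequality for the weighted derivative, the weight being frozen at `x`
      have hmv := (convex_closedBall x ‖a‖).norm_image_sub_le_of_norm_fderiv_le (𝕜 := ℝ)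
        (f := fun y => ‖x‖ ^ k • iteratedFDeriv ℝ m f y) (C := C) (x := x) (y := x - a)
        (fun y _ => (hd y).fun_const_smul _) (fun y hy => ?_) (by simp) (by simp)
      · rwa [← smul_sub, norm_smul, norm_pow, norm_norm, sub_sub_cancel_left, norm_neg] at hmv
      · rw [fderiv_fun_const_smul (hd y), norm_smul, norm_pow, norm_norm,
          norm_fderiv_iteratedFDeriv]
        refine le_trans ?_ (one_add_le_sup_seminorm_apply (𝕜 := ℝ) (m := (k, m + 1))
          le_rfl le_rfl f y)
        have hxy : ‖x‖ ≤ 1 + ‖y‖ := by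
          have h1 := norm_sub_norm_le x y
          have h2 : ‖x - y‖ ≤ ‖a‖ := by rw [norm_sub_rev]; exact mem_closedBall_iff_norm.1 hy
          linarith
        gcongr
    have hlim : Tendsto (fun a : E => C * ‖a‖) (𝓝 0) (𝓝 0) := by
      simpa using (tendsto_norm_zero (E := E)).const_mul C
    filter_upwards [hlim.eventually_lt_const hε, Metric.ball_mem_nhds (0 : E) one_pos] with a h1 h2
    exact (key a (by simpa using h2)).trans_lt h1
  refine continuous_iff_continuousAt.2 fun a => ?_
  have h1 : Tendsto (fun b : E => b - a) (𝓝 a) (𝓝 0) := by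
    simpa using (continuous_sub_right a).tendsto a
  refine ((h0 (compSubConstCLM ℝ a f)).comp h1).congr fun b => ?_
  simp [compSubConstCLM_comp]

variable [FiniteDimensional ℝ E]

/-- The smooth cutoff function `x ↦ f (x / (n + 1))`, where `f` is a fixed bump function equal to
`1` on the unit ball. The derivatives of the dilated bumps are bounded uniformly in `n`. -/
noncomputable def dilatedBump (n : ℕ) (x : E) : ℝ :=
  (⟨1, 2, one_pos, one_lt_two⟩ : ContDiffBump (0 : E)) (((n : ℝ) + 1)⁻¹ • x)

theorem contDiff_dilatedBump (n : ℕ) : ContDiff ℝ ∞ (dilatedBump n : E → ℝ) :=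
  (ContDiffBump.contDiff _).comp (contDiff_const_smul _)

theorem hasCompactSupport_dilatedBump (n : ℕ) : HasCompactSupport (dilatedBump n : E → ℝ) :=
  (ContDiffBump.hasCompactSupport _).comp_homeomorph
    (Homeomorph.smulOfNeZero (((n : ℝ) + 1)⁻¹) (by positivity))

theorem hasTemperateGrowth_dilatedBump (n : ℕ) :
    (dilatedBump n : E → ℝ).HasTemperateGrowth :=
  (hasCompactSupport_dilatedBump n).hasTemperateGrowth (contDiff_dilatedBump n)

theorem dilatedBump_nonneg (n : ℕ) (x : E) : 0 ≤ dilatedBump n x := ContDiffBump.nonneg _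

theorem dilatedBump_le_one (n : ℕ) (x : E) : dilatedBump n x ≤ 1 := ContDiffBump.le_one _

theorem dilatedBump_eq_one {n : ℕ} {x : E} (hx : ‖x‖ ≤ n + 1) : dilatedBump n x = 1 := by
  apply ContDiffBump.one_of_mem_closedBall
  rw [mem_closedBall_zero_iff, norm_smul, norm_inv, Real.norm_of_nonneg (by positivity)]
  exact inv_mul_le_one_of_le₀ hx (by positivity)

theorem tendsto_dilatedBump (x : E) : Tendsto (fun n => dilatedBump n x) atTop (𝓝 1) := by
  obtain ⟨m, hm⟩ := exists_nat_ge ‖x‖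
  refine tendsto_const_nhds.congr' ?_
  filter_upwards [eventually_ge_atTop m] with n hn
  have : (m : ℝ) ≤ n := by exact_mod_cast hn
  exact (dilatedBump_eq_one (by linarith)).symm

theorem exists_norm_iteratedFDeriv_dilatedBump_le (m : ℕ) :
    ∃ B : ℝ, 0 ≤ B ∧ ∀ i ≤ m, ∀ (n : ℕ) (x : E), ‖iteratedFDeriv ℝ i (dilatedBump n) x‖ ≤ B := by
  set f : ContDiffBump (0 : E) := ⟨1, 2, one_pos, one_lt_two⟩ with hf
  let F : 𝓢(E, ℝ) := f.hasCompactSupport.toSchwartzMap f.contDiff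
  refine ⟨∑ i ∈ Finset.range (m + 1), SchwartzMap.seminorm ℝ 0 i F,
    Finset.sum_nonneg fun i _ => apply_nonneg _ _, fun i hi n x => ?_⟩
  let g : E →L[ℝ] E := (((n : ℝ) + 1)⁻¹) • ContinuousLinearMap.id ℝ E
  have hg : ‖g‖ ≤ 1 := by
    refine ContinuousLinearMap.opNorm_le_bound _ zero_le_one fun y => ?_
    have h0 : ((n : ℝ) + 1)⁻¹ ≤ 1 := inv_le_one_of_one_le₀ (by linarith [n.cast_nonneg (α := ℝ)])
    simp only [g, smul_apply, ContinuousLinearMap.id_apply, norm_smul, norm_inv]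
    rw [Real.norm_of_nonneg (by positivity)]
    gcongr
  have h1 : (dilatedBump n : E → ℝ) = F ∘ g := rfl
  have h2 := g.iteratedFDeriv_comp_right (F.smooth ⊤) x (i := i) (by exact_mod_cast le_top)
  rw [h1, h2]
  calc _ ≤ ‖iteratedFDeriv ℝ i F (g x)‖ * ∏ _j : Fin i, ‖g‖ :=
        ContinuousMultilinearMap.norm_compContinuousLinearMap_le _ _
    _ ≤ ‖iteratedFDeriv ℝ i F (g x)‖ * 1 := by
        gcongr
        exact Finset.prod_le_one (fun _ _ => norm_nonneg _) fun _ _ => hg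
    _ ≤ SchwartzMap.seminorm ℝ 0 i F := by
        rw [mul_one]; exact F.norm_iteratedFDeriv_le_seminorm ℝ i _
    _ ≤ _ := Finset.single_le_sum (f := fun i => SchwartzMap.seminorm ℝ 0 i F)
        (fun i _ => apply_nonneg _ _) (Finset.mem_range.2 (by omega))

/-- The product of `φ` with the cutoff function `dilatedBump n`. -/
noncomputable def truncate (n : ℕ) (φ : 𝓢(E, F)) : 𝓢(E, F) :=
  smulLeftCLM F (dilatedBump n : E → ℝ) φ

@[simp]
theorem truncate_apply (n : ℕ) (φ : 𝓢(E, F)) (x : E) :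
    truncate n φ x = dilatedBump n x • φ x :=
  smulLeftCLM_apply_apply (hasTemperateGrowth_dilatedBump n) φ x

theorem hasCompactSupport_truncate (n : ℕ) (φ : 𝓢(E, F)) : HasCompactSupport (truncate n φ) := by
  have : (truncate n φ : E → F) = fun x => dilatedBump n x • φ x := funext (truncate_apply n φ)
  rw [this]
  exact (hasCompactSupport_dilatedBump n).smul_right

/-- Compactly supported functions are dense in the Schwartz space. -/
theorem tendsto_truncate (φ : 𝓢(E, F)) : Tendsto (fun n => truncate n φ) atTop (𝓝 φ) := by
  rw [(schwartz_withSeminorms ℝ E F).tendsto_nhds]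
  rintro ⟨k, m⟩ ε hε
  obtain ⟨B, hB0, hB⟩ := exists_norm_iteratedFDeriv_dilatedBump_le (E := E) m
  set C : ℝ := (∑ i ∈ Finset.range (m + 1), (m.choose i : ℝ) * B *
    SchwartzMap.seminorm ℝ (k + 1) (m - i) φ) + SchwartzMap.seminorm ℝ (k + 1) m φ with hC
  have hC0 : 0 ≤ C := add_nonneg (Finset.sum_nonneg fun i _ => by positivity) (by positivity)
  have key : ∀ n : ℕ, SchwartzMap.seminorm ℝ k m (truncate n φ - φ) ≤ C / (n + 1) := by
    intro n
    refine seminorm_le_bound ℝ k m _ (by positivity) fun x => ?_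
    -- the difference vanishes on the ball of radius `n + 1`; outside of it, one more power of `‖x‖`
    -- pays for the factor `1 / (n + 1)`
    rcases lt_or_ge ‖x‖ (n + 1) with hx | hx
    · have h0 : (truncate n φ - φ : 𝓢(E, F)) =ᶠ[𝓝 x] (fun _ => (0 : F)) := by
        filter_upwards [(isOpen_lt continuous_norm continuous_const).mem_nhds hx] with y hy
        have hy' : ‖y‖ < n + 1 := hy
        simp [dilatedBump_eq_one hy'.le]
      rw [(h0.iteratedFDeriv ℝ m).eq_of_nhds]
      simp only [iteratedFDeriv_fun_zero, Pi.zero_apply, norm_zero, mul_zero]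
      positivity
    · have hn : (0 : ℝ) < n + 1 := by positivity
      have hk : ‖x‖ ^ k ≤ ‖x‖ ^ (k + 1) / (n + 1) := by
        rw [le_div_iff₀ hn, pow_succ]; gcongr
      have hcoe : ((truncate n φ - φ : 𝓢(E, F)) : E → F)
          = (fun y => dilatedBump n y • φ y) - φ := by
        ext y; simp
      have h1 : ‖iteratedFDeriv ℝ m (truncate n φ - φ : 𝓢(E, F)) x‖ ≤
          (∑ i ∈ Finset.range (m + 1), (m.choose i : ℝ) * B * ‖iteratedFDeriv ℝ (m - i) φ x‖)
            + ‖iteratedFDeriv ℝ m φ x‖ := by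
        have hs : ContDiff ℝ m fun y => dilatedBump n y • φ y :=
          ((contDiff_dilatedBump n).smul (φ.smooth ⊤)).of_le (by exact_mod_cast le_top)
        rw [hcoe, iteratedFDeriv_sub_apply hs.contDiffAt (φ.contDiffAt m)]
        refine (norm_sub_le _ _).trans (add_le_add ?_ le_rfl)
        refine (norm_iteratedFDeriv_smul_le (contDiff_dilatedBump n) (φ.smooth ⊤) x
          (by exact_mod_cast le_top)).trans ?_
        refine Finset.sum_le_sum fun i hi => ?_
        have := hB i (by simpa [Nat.lt_succ_iff] using hi) n x
        gcongr
      calc _ ≤ ‖x‖ ^ (k + 1) / (n + 1) * ((∑ i ∈ Finset.range (m + 1), (m.choose i : ℝ) * B *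
              ‖iteratedFDeriv ℝ (m - i) φ x‖) + ‖iteratedFDeriv ℝ m φ x‖) := by gcongr
        _ = ((∑ i ∈ Finset.range (m + 1), (m.choose i : ℝ) * B *
              (‖x‖ ^ (k + 1) * ‖iteratedFDeriv ℝ (m - i) φ x‖))
              + ‖x‖ ^ (k + 1) * ‖iteratedFDeriv ℝ m φ x‖) / (n + 1) := by
            rw [div_mul_eq_mul_div, mul_add, Finset.mul_sum]
            congr 2
            exact Finset.sum_congr rfl fun i _ => by ring
        _ ≤ C / (n + 1) := by
            rw [hC]
            gcongr
            · exact φ.le_seminorm ℝ _ _ x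
            · exact φ.le_seminorm ℝ _ _ x
  have hlim : Tendsto (fun n : ℕ => C / ((n : ℝ) + 1)) atTop (𝓝 0) :=
    by simpa [div_eq_mul_inv] using tendsto_one_div_add_atTop_nhds_zero_nat.const_mul C
  filter_upwards [hlim.eventually_lt_const hε] with n hn
  exact (key n).trans_lt hn

/-- Two tempered distributions which agree on compactly supported functions are equal. -/
theorem clm_ext_of_hasCompactSupport {T T' : 𝓢'(E, ℂ)}
    (h : ∀ φ : 𝓢(E, ℂ), HasCompactSupport φ → T φ = T' φ) : T = T' := by
  ext φ
  have h1 := ((map_continuous T).tendsto φ).comp (tendsto_truncate φ)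
  have h2 := ((map_continuous T').tendsto φ).comp (tendsto_truncate φ)
  refine tendsto_nhds_unique h1 (h2.congr fun n => ?_)
  exact (h _ (hasCompactSupport_truncate n φ)).symm

end Schwartz
/-! ### Distributions given by a function with integrable exponential -/

section GivenBy

open Filter SchwartzMap

variable {N : ℕ} {T : 𝓢'(Sp N, ℂ)} {a : Sp N → ℝ}

theorem integrable_mul_of_hasCompactSupport (hT : IsGivenBy T a) {f : Sp N → ℝ}
    (hf : Continuous f) (hf' : HasCompactSupport f) : Integrable fun x => f x * a x :=
  hT.1.integrable_smul_left_of_hasCompactSupport hf hf'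

/-- A nonnegative Schwartz function `p` is integrable against a function `a` which defines a
tempered distribution and whose exponential is integrable. Indeed `a⁺ ≤ exp a`, so the integral
of `p a⁺` is finite, and the integral of `p a⁻` is the limit of truncated ones, which are controlled
by the former and by the values of the distribution. -/
theorem integrable_mul_of_nonneg (hT : IsGivenBy T a) (ha : Integrable fun x => Real.exp (a x))
    (ψ : 𝓢(Sp N, ℂ)) {p : Sp N → ℝ} (hp : ∀ x, 0 ≤ p x) (hψ : ∀ x, ψ x = p x) :
    Integrable fun x => p x * a x := by
  have hpc : Continuous p := by
    have : p = fun x => (ψ x).re := by ext x; simp [hψ]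
    rw [this]; exact Complex.continuous_re.comp ψ.continuous
  have ham : AEStronglyMeasurable a := hT.1.aestronglyMeasurable
  set χ : ℕ → Sp N → ℝ := fun n => dilatedBump n with hχ
  have hχc : ∀ n, Continuous (χ n) := fun n => (contDiff_dilatedBump n).continuous
  have hpos : Integrable fun x => p x * max (a x) 0 := by
    refine (ha.const_mul (SchwartzMap.seminorm ℝ 0 0 ψ)).mono'
      (hpc.aestronglyMeasurable.mul (ham.sup aestronglyMeasurable_const)) (ae_of_all _ fun x => ?_)
    have h1 : p x ≤ SchwartzMap.seminorm ℝ 0 0 ψ := by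
      have := ψ.norm_le_seminorm ℝ x
      rwa [hψ, Complex.norm_real, Real.norm_of_nonneg (hp x)] at this
    have h2 : max (a x) 0 ≤ Real.exp (a x) :=
      max_le (by linarith [Real.add_one_le_exp (a x)]) (Real.exp_pos _).le
    rw [Real.norm_of_nonneg (mul_nonneg (hp x) (le_max_right _ _))]
    exact mul_le_mul h1 h2 (le_max_right _ _) (apply_nonneg _ _)
  have hcut : ∀ n, Integrable fun x => χ n x * p x * a x := fun n =>
    integrable_mul_of_hasCompactSupport hT ((hχc n).mul hpc)
      ((hasCompactSupport_dilatedBump n).mul_right)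
  have hcutp : ∀ n, Integrable fun x => χ n x * p x * max (a x) 0 := fun n => by
    have hloc : LocallyIntegrable fun x => max (a x) 0 :=
      hT.1.mono (ham.sup aestronglyMeasurable_const) (ae_of_all _ fun x => by
        rw [Real.norm_of_nonneg (le_max_right _ _), Real.norm_eq_abs]
        exact max_le (le_abs_self _) (abs_nonneg _))
    exact hloc.integrable_smul_left_of_hasCompactSupport ((hχc n).mul hpc)
      ((hasCompactSupport_dilatedBump n).mul_right)
  have hneg_eq : ∀ t : ℝ, max (-t) 0 = max t 0 - t := fun t => by
    rcases le_total t 0 with h | h <;> simp [h]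
  have hcutn : ∀ n, Integrable fun x => χ n x * p x * max (-a x) 0 := fun n => by
    refine ((hcutp n).sub (hcut n)).congr (ae_of_all _ fun x => ?_)
    simp only [Pi.sub_apply, hneg_eq]; ring
  have hTn : ∀ n, T (truncate n ψ) = ((∫ x, χ n x * p x * a x : ℝ) : ℂ) := fun n => by
    rw [hT.2 _ (hasCompactSupport_truncate n ψ), ← integral_complex_ofReal]
    congr 1; ext x; simp [hψ, hχ]
  have hlim : Tendsto (fun n => ∫ x, χ n x * p x * a x) atTop (𝓝 (T ψ).re) := by
    have := (Complex.continuous_re.tendsto _).comp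
      (((map_continuous T).tendsto ψ).comp (tendsto_truncate ψ))
    refine this.congr fun n => ?_
    simp [hTn]
  -- a convergent sequence is bounded below, which bounds the truncated integrals of `p a⁻` above
  obtain ⟨m, hm⟩ := hlim.bddBelow_range
  have hbound : ∀ n, ∫ x, χ n x * p x * max (-a x) 0 ≤ (∫ x, p x * max (a x) 0) - m := fun n => by
    have h1 : ∫ x, χ n x * p x * max (-a x) 0
        = (∫ x, χ n x * p x * max (a x) 0) - ∫ x, χ n x * p x * a x := by
      rw [← integral_sub (hcutp n) (hcut n)]
      congr 1; ext x; rw [hneg_eq]; ring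
    have h2 : ∫ x, χ n x * p x * max (a x) 0 ≤ ∫ x, p x * max (a x) 0 := by
      refine integral_mono (hcutp n) hpos fun x => ?_
      have := mul_nonneg (hp x) (le_max_right (a x) 0)
      have := mul_le_of_le_one_left this (dilatedBump_le_one n x)
      simpa [hχ, mul_assoc] using this
    have h3 := hm (Set.mem_range_self n)
    linarith
  have heq : ∀ n : ℕ, ∀ x ∈ Metric.closedBall (0 : Sp N) n,
      χ n x * p x * max (-a x) 0 = p x * max (-a x) 0 := fun n x hx => by
    rw [mem_closedBall_zero_iff] at hx
    simp [hχ, dilatedBump_eq_one (hx.trans (by linarith : (n : ℝ) ≤ n + 1))]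
  have hneg : Integrable fun x => p x * max (-a x) 0 := by
    refine (aecover_closedBall (x := (0 : Sp N)) (r := fun n : ℕ => (n : ℝ))
      tendsto_natCast_atTop_atTop).integrable_of_integral_norm_bounded
      ((∫ x, p x * max (a x) 0) - m) (fun n => ?_) (Eventually.of_forall fun n => ?_)
    · exact (hcutn n).integrableOn.congr_fun (heq n) measurableSet_closedBall
    · refine le_trans (le_trans (le_of_eq ?_) (setIntegral_le_integral
        (s := Metric.closedBall (0 : Sp N) n) (hcutn n) (ae_of_all _ fun x => ?_))) (hbound n)
      · refine setIntegral_congr_fun measurableSet_closedBall fun x hx => ?_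
        simp only [heq n x hx]
        exact Real.norm_of_nonneg (mul_nonneg (hp x) (le_max_right _ _))
      · exact mul_nonneg (mul_nonneg (dilatedBump_nonneg n x) (hp x)) (le_max_right _ _)
  refine (hpos.sub hneg).congr (ae_of_all _ fun x => ?_)
  simp only [Pi.sub_apply, hneg_eq]; ring

theorem apply_eq_integral_of_integrable (hT : IsGivenBy T a) (ψ : 𝓢(Sp N, ℂ))
    (hψ : Integrable fun x => ψ x * (a x : ℂ)) : T ψ = ∫ x, ψ x * (a x : ℂ) := by
  have h1 := ((map_continuous T).tendsto ψ).comp (tendsto_truncate ψ)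
  refine tendsto_nhds_unique h1 ?_
  have h2 : ∀ n, (T ∘ fun n => truncate n ψ) n
      = ∫ x, (dilatedBump n x : ℂ) * (ψ x * (a x : ℂ)) := fun n => by
    simp only [Function.comp, hT.2 _ (hasCompactSupport_truncate n ψ)]
    congr 1; ext x; simp [mul_assoc]
  refine Tendsto.congr (fun n => (h2 n).symm) ?_
  refine tendsto_integral_of_dominated_convergence (fun x => ‖ψ x * (a x : ℂ)‖) (fun n => ?_)
    hψ.norm (fun n => ae_of_all _ fun x => ?_) (ae_of_all _ fun x => ?_)
  · exact (Complex.continuous_ofReal.comp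
      (contDiff_dilatedBump n).continuous).aestronglyMeasurable.mul hψ.1
  · rw [norm_mul, Complex.norm_real, Real.norm_of_nonneg (dilatedBump_nonneg n x)]
    exact mul_le_of_le_one_left (norm_nonneg _) (dilatedBump_le_one n x)
  · have := ((Complex.continuous_ofReal.tendsto 1).comp (tendsto_dilatedBump x)).mul_const
      (ψ x * (a x : ℂ))
    simpa using this

/-- A real Schwartz function as a complex one. -/
noncomputable def complexify (b : 𝓢(Sp N, ℝ)) : 𝓢(Sp N, ℂ) := b.postcompCLM Complex.ofRealCLM

@[simp]
theorem complexify_apply (b : 𝓢(Sp N, ℝ)) (x : Sp N) : complexify b x = (b x : ℂ) := rfl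

/-- The convolution of a test function with a real Schwartz function. -/
noncomputable def convolve (φ : 𝓢(Sp N, ℂ)) (b : 𝓢(Sp N, ℝ)) : 𝓢(Sp N, ℂ) :=
  SchwartzMap.convolution (ContinuousLinearMap.mul ℂ ℂ) φ (complexify b)

theorem convolve_apply (φ : 𝓢(Sp N, ℂ)) (b : 𝓢(Sp N, ℝ)) (x : Sp N) :
    convolve φ b x = ∫ y, φ y * (b (x - y) : ℂ) := by
  simp [convolve, SchwartzMap.convolution_apply, MeasureTheory.convolution]

variable {b : 𝓢(Sp N, ℝ)}

theorem integrable_translate_mul (hT : IsGivenBy T a) (ha : Integrable fun x => Real.exp (a x))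
    (hb : ∀ x, 0 ≤ b x) (y : Sp N) : Integrable fun x => b (x - y) * a x :=
  integrable_mul_of_nonneg hT ha (compSubConstCLM ℝ y (complexify b)) (fun x => hb (x - y))
    fun x => by simp

theorem apply_translate (hT : IsGivenBy T a) (ha : Integrable fun x => Real.exp (a x))
    (hb : ∀ x, 0 ≤ b x) (y : Sp N) :
    T (compSubConstCLM ℝ y (complexify b)) = ((∫ x, b (x - y) * a x : ℝ) : ℂ) := by
  have h := (integrable_translate_mul hT ha hb y).ofReal (𝕜 := ℂ)
  rw [apply_eq_integral_of_integrable hT _ (by simpa using h), ← integral_complex_ofReal]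
  simp

theorem continuous_integral_translate (hT : IsGivenBy T a)
    (ha : Integrable fun x => Real.exp (a x)) (hb : ∀ x, 0 ≤ b x) :
    Continuous fun y => ∫ x, b (x - y) * a x := by
  have h := Complex.continuous_re.comp
    ((map_continuous T).comp (continuous_compSubConst (complexify b)))
  refine h.congr fun y => ?_
  simp [apply_translate hT ha hb]

/-- Every compactly supported test function is dominated by a nonnegative one. -/
theorem exists_le_hasCompactSupport (φ : 𝓢(Sp N, ℂ)) (hφ : HasCompactSupport φ) :
    ∃ η : 𝓢(Sp N, ℝ), HasCompactSupport η ∧ ∀ x, ‖φ x‖ ≤ η x := by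
  obtain ⟨n, hn⟩ : ∃ n : ℕ, ∀ x, (n : ℝ) < ‖x‖ → φ x = 0 := by
    obtain ⟨M, hM⟩ := hφ.isCompact.isBounded.subset_closedBall (0 : Sp N)
    obtain ⟨n, hn⟩ := exists_nat_ge M
    refine ⟨n, fun x hx => image_eq_zero_of_notMem_tsupport fun hx' => ?_⟩
    have := mem_closedBall_zero_iff.1 (hM hx')
    linarith
  set C := SchwartzMap.seminorm ℝ 0 0 φ
  refine ⟨C • (hasCompactSupport_dilatedBump n).toSchwartzMap (contDiff_dilatedBump n),
    (hasCompactSupport_dilatedBump n).smul_left, fun x => ?_⟩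
  change ‖φ x‖ ≤ C * dilatedBump n x
  rcases lt_or_ge (n : ℝ) ‖x‖ with hx | hx
  · rw [hn x hx, norm_zero]
    exact mul_nonneg (apply_nonneg _ _) (dilatedBump_nonneg n x)
  · rw [dilatedBump_eq_one (by linarith), mul_one]
    exact φ.norm_le_seminorm ℝ x

/-- Pairing `T` with a convolution amounts to integrating the pairings of `T` with the translates of
the kernel. -/
theorem apply_convolve (hT : IsGivenBy T a) (ha : Integrable fun x => Real.exp (a x))
    (hb : ∀ x, 0 ≤ b x) (φ : 𝓢(Sp N, ℂ)) (hφ : HasCompactSupport φ) :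
    T (convolve φ b) = ∫ y, φ y * ((∫ x, b (x - y) * a x : ℝ) : ℂ) := by
  obtain ⟨η, hη, hφη⟩ := exists_le_hasCompactSupport φ hφ
  have hη0 : ∀ x, 0 ≤ η x := fun x => (norm_nonneg _).trans (hφη x)
  have hbm : Continuous fun z : Sp N × Sp N => b (z.2 - z.1) :=
    b.continuous.comp (continuous_snd.sub continuous_fst)
  have ham : AEStronglyMeasurable (fun z : Sp N × Sp N => a z.2) (volume.prod volume) :=
    hT.1.aestronglyMeasurable.comp_snd
  -- by Tonelli it suffices that the convolution of `η` and `b`, a nonnegative Schwartz function, is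
  -- integrable against `a`
  have hdom : Integrable (fun z : Sp N × Sp N => η z.1 * (b (z.2 - z.1) * a z.2))
      (volume.prod volume) := by
    refine (integrable_prod_iff' ((η.continuous.comp continuous_fst).aestronglyMeasurable.mul
      (hbm.aestronglyMeasurable.mul ham))).2 ⟨?_, ?_⟩
    · refine ae_of_all _ fun x => ?_
      have : Integrable fun y => η y * b (x - y) :=
        (η.continuous.mul (b.continuous.comp (continuous_const.sub
          continuous_id))).integrable_of_hasCompactSupport hη.mul_right
      simpa [mul_assoc] using this.mul_const (a x)
    · have h1 := integrable_mul_of_nonneg hT ha (convolve (complexify η) b)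
        (p := fun x => ∫ y, η y * b (x - y))
        (fun x => integral_nonneg fun y => mul_nonneg (hη0 y) (hb _))
        (fun x => by rw [convolve_apply, ← integral_complex_ofReal]; simp)
      refine h1.norm.congr (ae_of_all _ fun x => ?_)
      have h0 : 0 ≤ ∫ y, η y * b (x - y) :=
        integral_nonneg fun y => mul_nonneg (hη0 y) (hb _)
      simp only [norm_mul, Real.norm_of_nonneg h0]
      rw [← integral_mul_const]
      simp [mul_assoc, fun y => abs_of_nonneg (hη0 y), fun y => abs_of_nonneg (hb y)]
  have hint : Integrable (fun z : Sp N × Sp N => φ z.1 * ((b (z.2 - z.1) * a z.2 : ℝ) : ℂ))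
      (volume.prod volume) := by
    refine hdom.norm.mono' ((φ.continuous.comp continuous_fst).aestronglyMeasurable.mul
      (Complex.continuous_ofReal.comp_aestronglyMeasurable
        (hbm.aestronglyMeasurable.mul ham))) (ae_of_all _ fun z => ?_)
    rw [norm_mul, norm_mul, Complex.norm_real, Real.norm_of_nonneg (hη0 _)]
    gcongr
    exact hφη _
  have hcoe : ∀ x, convolve φ b x * (a x : ℂ)
      = ∫ y, φ y * ((b (x - y) * a x : ℝ) : ℂ) := fun x => by
    rw [convolve_apply, ← integral_mul_const]
    simp [mul_assoc]
  rw [apply_eq_integral_of_integrable hT]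
  · simp_rw [hcoe]
    rw [← integral_integral_swap (f := fun y x => φ y * ((b (x - y) * a x : ℝ) : ℂ)) hint]
    simp_rw [integral_const_mul, integral_complex_ofReal]
  · simp_rw [hcoe]
    exact hint.integral_prod_right

theorem integral_convolve (hb : ∫ x, b x = 1) (φ : 𝓢(Sp N, ℂ)) :
    ∫ x, convolve φ b x = ∫ x, φ x := by
  have h : (convolve φ b : Sp N → ℂ) = MeasureTheory.convolution φ (complexify b)
      (ContinuousLinearMap.mul ℂ ℂ) volume := by
    ext x; simp [convolve, SchwartzMap.convolution_apply]
  rw [h, MeasureTheory.integral_convolution _ φ.integrable (complexify b).integrable]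
  simp only [complexify_apply, integral_complex_ofReal, hb]
  simp

end GivenBy
/-! ### Division of compactly supported distributions -/

section Quotient

open Filter SchwartzMap

open scoped Manifold

variable {N : ℕ}

/-- A distribution annihilates the test functions whose support is compact and disjoint from its
own: locally this is the definition of the support, and a partition of unity makes it global. -/
theorem apply_eq_zero_of_tsupport_subset (S : 𝓢'(Sp N, ℂ)) (u : 𝓢(Sp N, ℂ))
    (hu : HasCompactSupport u) (h : tsupport u ⊆ (dsupport S)ᶜ) : S u = 0 := by
  have hloc : ∀ x ∈ tsupport u, ∃ V : Set (Sp N), IsVanishingOn S V ∧ IsOpen V ∧ x ∈ V :=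
    fun x hx => (notMem_dsupport_iff x).1 (h hx)
  choose V hV hVo hxV using hloc
  obtain ⟨t, ht⟩ := hu.isCompact.elim_nhds_subcover' V fun x hx => (hVo x hx).mem_nhds (hxV x hx)
  obtain ⟨ρ, hρ⟩ := SmoothPartitionOfUnity.exists_isSubordinate 𝓘(ℝ, Sp N)
    (isClosed_tsupport u) (fun i : t => V i.1.1 i.1.2) (fun i => hVo _ _)
    (fun x hx => by
      obtain ⟨i, hi, hxi⟩ := Set.mem_iUnion₂.1 (ht hx)
      exact Set.mem_iUnion.2 ⟨⟨i, hi⟩, hxi⟩)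
  have hs : ∀ i : t, ContDiff ℝ ∞ fun x => ((ρ i x : ℝ) : ℂ) * u x := fun i =>
    (Complex.ofRealCLM.contDiff.comp (ρ i).contMDiff.contDiff).mul (u.smooth ⊤)
  let v : t → 𝓢(Sp N, ℂ) := fun i => (hu.mul_left (f := fun x => ((ρ i x : ℝ) : ℂ))).toSchwartzMap
    (hs i)
  have huv : u = ∑ i, v i := by
    ext x
    have hv : ∀ i, v i x = ((ρ i x : ℝ) : ℂ) * u x := fun i => rfl
    rw [sum_apply]
    simp_rw [hv, ← Finset.sum_mul]
    by_cases hx : x ∈ tsupport u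
    · have := ρ.sum_eq_one hx
      rw [finsum_eq_sum_of_fintype] at this
      rw [← Complex.ofReal_sum, this]; simp
    · simp [image_eq_zero_of_notMem_tsupport hx]
  rw [huv, map_sum]
  refine Finset.sum_eq_zero fun i _ => hV i.1.1 i.1.2 _ ?_
  refine Set.Subset.trans ?_ (hρ i)
  refine closure_mono fun x hx hx' => hx ?_
  change ((ρ i x : ℝ) : ℂ) * u x = 0
  simp [hx']

variable {S W : 𝓢'(Sp N, ℂ)} {χ g : Sp N → ℂ}

theorem IsCutoff.hasTemperateGrowth (hχ : IsCutoff S χ) : χ.HasTemperateGrowth :=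
  hχ.2.1.hasTemperateGrowth hχ.1

theorem IsCutoff.apply_eq_zero (hχ : IsCutoff S χ) (v : 𝓢(Sp N, ℂ)) (hv : HasCompactSupport v)
    {f : Sp N → ℂ} (hvf : ∀ x, v x = (1 - χ x) * f x) : S v = 0 := by
  refine apply_eq_zero_of_tsupport_subset S v hv fun x hx hxS => ?_
  refine notMem_tsupport_iff_eventuallyEq.2 ?_ hx
  filter_upwards [hχ.2.2.filter_mono (nhds_le_nhdsSet hxS)] with y hy
  simp [hvf, hy]

theorem IsCutoff.smulLeftCLM_eq (hχ : IsCutoff S χ) :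
    TemperedDistribution.smulLeftCLM ℂ χ S = S := by
  refine clm_ext_of_hasCompactSupport fun φ hφ => ?_
  rw [TemperedDistribution.smulLeftCLM_apply_apply, eq_comm, ← sub_eq_zero, ← map_sub]
  have h : ∀ x, (φ - smulLeftCLM ℂ χ φ) x = (1 - χ x) * φ x := fun x => by
    rw [sub_apply, smulLeftCLM_apply_apply hχ.hasTemperateGrowth, smul_eq_mul]; ring
  refine hχ.apply_eq_zero _ ?_ h
  rw [show ((φ - smulLeftCLM ℂ χ φ : 𝓢(Sp N, ℂ)) : Sp N → ℂ) = fun x => (1 - χ x) * φ x from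
    funext h]
  exact hφ.mul_left

theorem IsCutoff.hasTemperateGrowth_div (hχ : IsCutoff S χ) (hg : ContDiff ℝ ∞ g)
    (hg0 : ∀ ξ, g ξ ≠ 0) : (fun ξ => χ ξ / g ξ).HasTemperateGrowth := by
  have h : HasCompactSupport fun ξ => χ ξ / g ξ := by
    simp_rw [div_eq_mul_inv]; exact hχ.2.1.mul_right
  refine h.hasTemperateGrowth ?_
  simp_rw [div_eq_mul_inv]
  exact hχ.1.mul (hg.inv hg0)

/-- For a multiplier `g` without zeros, `S / g = W` if and only if `S = g W`: a distribution `W`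
with `g W` compactly supported is itself supported there. -/
theorem quotient_eq_iff (hS : IsCompact (dsupport S)) (hg : g.HasTemperateGrowth)
    (hg0 : ∀ ξ, g ξ ≠ 0) : quotient S g = W ↔ S = TemperedDistribution.smulLeftCLM ℂ g W := by
  have hex := exists_isCutoff S hS
  rw [quotient, dif_pos hex]
  have hχ : IsCutoff S hex.choose := hex.choose_spec
  generalize hex.choose = χ at hχ
  have hd := hχ.hasTemperateGrowth_div hg.1 hg0
  have hmul : (fun ξ => χ ξ / g ξ) * g = χ := by
    ext ξ; simp [hg0 ξ]
  constructor
  · rintro rfl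
    rw [TemperedDistribution.smulLeftCLM_smulLeftCLM_apply hd hg, hmul, hχ.smulLeftCLM_eq]
  · intro h
    have hW : TemperedDistribution.smulLeftCLM ℂ (fun ξ => χ ξ / g ξ) S
        = TemperedDistribution.smulLeftCLM ℂ χ W := by
      conv_lhs => rw [h]
      rw [TemperedDistribution.smulLeftCLM_smulLeftCLM_apply hg hd, mul_comm, hmul]
    rw [hW]
    refine clm_ext_of_hasCompactSupport fun φ hφ => ?_
    rw [TemperedDistribution.smulLeftCLM_apply_apply, eq_comm, ← sub_eq_zero, ← map_sub]
    -- `W ((1 - χ) φ) = (g W) ((1 - χ) φ / g) = S ((1 - χ) φ / g) = 0`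
    have hc : HasCompactSupport fun x => (1 - χ x) * (φ x * (g x)⁻¹) := hφ.mul_right.mul_left
    let v : 𝓢(Sp N, ℂ) := hc.toSchwartzMap
      ((contDiff_const.sub hχ.1).mul ((φ.smooth ⊤).mul (hg.1.inv hg0)))
    have hv : φ - smulLeftCLM ℂ χ φ = smulLeftCLM ℂ g v := by
      ext x
      rw [sub_apply, smulLeftCLM_apply_apply hχ.hasTemperateGrowth,
        smulLeftCLM_apply_apply hg]
      change φ x - χ x * φ x = g x * ((1 - χ x) * (φ x * (g x)⁻¹))
      field_simp [hg0 x]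
    rw [hv, ← TemperedDistribution.smulLeftCLM_apply_apply, ← h]
    exact hχ.apply_eq_zero v hc fun x => rfl

/-! ### The convolution equation -/

theorem fourierInv_convolve (φ : 𝓢(Sp N, ℂ)) (b : 𝓢(Sp N, ℝ)) :
    𝓕⁻ (convolve φ b) = smulLeftCLM ℂ (𝓕⁻ (complexify b) : 𝓢(Sp N, ℂ)) (𝓕⁻ φ) := by
  ext ξ
  rw [smulLeftCLM_apply_apply (SchwartzMap.hasTemperateGrowth _)]
  simp only [fourierInv_apply_eq, convolve, SchwartzMap.fourier_convolution,
    compCLMOfContinuousLinearEquiv_apply, Function.comp]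
  simp [mul_comm]

/-- The Fourier transform of the reflected density `b̌` is the inverse Fourier transform of `b`. -/
theorem fourier_reflect (b : 𝓢(Sp N, ℝ)) :
    𝓕 (fun x => (b (-x) : ℂ)) = (𝓕⁻ (complexify b) : 𝓢(Sp N, ℂ)) := by
  rw [SchwartzMap.fourierInv_coe, Real.fourierInv_eq_fourier_comp_neg]
  rfl

/-- The distribution `logPrior b R` is characterized, for a density `b` whose Fourier transform
has no zeros, by the convolution equation `R = - Ent b - b̌ * T`. -/
theorem logPrior_eq_iff {b : 𝓢(Sp N, ℝ)} {R T : 𝓢'(Sp N, ℂ)} (hb : ∫ x, b x = 1)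
    (hb0 : ∀ ξ, 𝓕 (fun x => (b x : ℂ)) ξ ≠ 0)
    (hR : IsCompact (dsupport (𝓕 R : 𝓢'(Sp N, ℂ)))) :
    logPrior b R = T ↔ ∀ φ : 𝓢(Sp N, ℂ), HasCompactSupport φ →
      R φ = -(Ent b : ℂ) * (∫ x, φ x) - T (convolve φ b) := by
  set W : 𝓢'(Sp N, ℂ) :=
    -((Ent b : ℂ) • (volume : Measure (Sp N)).toTemperedDistribution) - T with hW
  set g : 𝓢(Sp N, ℂ) := 𝓕⁻ (complexify b) with hg
  have hg0 : ∀ ξ, g ξ ≠ 0 := fun ξ => hb0 (-ξ)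
  have hWφ : ∀ φ, W (convolve φ b) = -(Ent b : ℂ) * (∫ x, φ x) - T (convolve φ b) := fun φ => by
    rw [← integral_convolve hb φ]
    simp [hW]
  have h1 : logPrior b R = T ↔ quotient (𝓕 R) g = 𝓕 W := by
    rw [logPrior, fourier_reflect, ← hg]
    constructor
    · intro h; rw [hW, ← h]; simp
    · intro h; rw [h, hW]; simp
  have h2 : 𝓕 R = TemperedDistribution.smulLeftCLM ℂ g (𝓕 W) ↔
      R = 𝓕⁻ (TemperedDistribution.smulLeftCLM ℂ g (𝓕 W)) := by
    constructor
    · intro h; rw [← h]; simp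
    · intro h; rw [h]; simp
  have h3 : ∀ φ : 𝓢(Sp N, ℂ),
      (𝓕⁻ (TemperedDistribution.smulLeftCLM ℂ g (𝓕 W)) : 𝓢'(Sp N, ℂ)) φ = W (convolve φ b) := by
    intro φ
    rw [TemperedDistribution.fourierInv_apply, TemperedDistribution.smulLeftCLM_apply_apply,
      TemperedDistribution.fourier_apply, hg, ← fourierInv_convolve]
    simp
  rw [h1, quotient_eq_iff hR g.hasTemperateGrowth hg0, h2]
  constructor
  · intro h φ _
    rw [← hWφ, ← h3, ← h]
  · intro h
    refine clm_ext_of_hasCompactSupport fun φ hφ => ?_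
    rw [h φ hφ, h3, hWφ]

/-- The convolution equation holds in the sense of distributions if and only if it holds pointwise:
by Fubini's theorem the right-hand side is the distribution given by a continuous function. -/
theorem logPrior_eq_iff_integral {b : 𝓢(Sp N, ℝ)} {R T : 𝓢'(Sp N, ℂ)} {a r : Sp N → ℝ}
    (hb_nonneg : ∀ x, 0 ≤ b x) (hb : ∫ x, b x = 1)
    (hb0 : ∀ ξ, 𝓕 (fun x => (b x : ℂ)) ξ ≠ 0) (hr : Continuous r) (hRr : IsGivenBy R r)
    (hR : IsCompact (dsupport (𝓕 R : 𝓢'(Sp N, ℂ))))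
    (hT : IsGivenBy T a) (ha : Integrable fun x => Real.exp (a x)) :
    logPrior b R = T ↔ ∀ y, r y = -Ent b - ∫ x, b (x - y) * a x := by
  have hI := continuous_integral_translate hT ha hb_nonneg
  set I : Sp N → ℝ := fun y => ∫ x, b (x - y) * a x with hIdef
  have hφI : ∀ φ : 𝓢(Sp N, ℂ), HasCompactSupport φ →
      -(Ent b : ℂ) * (∫ x, φ x) - T (convolve φ b) = ∫ y, φ y * ((-Ent b - I y : ℝ) : ℂ) := by
    intro φ hφ
    have hint : Integrable fun y => φ y * (I y : ℂ) :=
      (φ.continuous.mul (Complex.continuous_ofReal.comp hI)).integrable_of_hasCompactSupport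
        hφ.mul_right
    rw [apply_convolve hT ha hb_nonneg φ hφ, ← integral_const_mul,
      ← integral_sub (φ.integrable.const_mul _) hint]
    congr 1; ext y; push_cast; ring
  rw [logPrior_eq_iff hb hb0 hR]
  constructor
  · intro h
    have hae : r =ᵐ[volume] fun y => -Ent b - I y := by
      have hc : Continuous fun y => -Ent b - I y := continuous_const.sub hI
      refine ae_eq_of_integral_contDiff_smul_eq hr.locallyIntegrable hc.locallyIntegrable ?_
      intro f hf hfc
      let φ : 𝓢(Sp N, ℂ) := complexify (hfc.toSchwartzMap hf)
      have hφ : HasCompactSupport φ := hfc.comp_left (g := fun t : ℝ => (t : ℂ)) Complex.ofReal_zero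
      have h1 := h φ hφ
      rw [hφI φ hφ, hRr.2 φ hφ] at h1
      have h2 : ∀ k : Sp N → ℝ, ∫ y, φ y * (k y : ℂ) = ((∫ y, f y • k y : ℝ) : ℂ) := fun k => by
        rw [← integral_complex_ofReal]
        congr 1; ext y; simp [φ]
      rw [h2, h2 fun y => -Ent b - I y] at h1
      exact_mod_cast h1
    exact congrFun ((Continuous.ae_eq_iff_eq _ hr (continuous_const.sub hI)).1 hae)
  · intro h φ hφ
    rw [hφI φ hφ, hRr.2 φ hφ]
    simp_rw [h]
    rfl

end Quotient
/-! ### The Kullback-Leibler divergence of two densities -/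

section Divergence

open InformationTheory

variable {N : ℕ} {p q : Sp N → ℝ}

theorem IsProbDensity.isProbabilityMeasure (hp : IsProbDensity p) :
    IsProbabilityMeasure (densityMeasure p) := by
  refine ⟨?_⟩
  rw [densityMeasure, withDensity_apply _ MeasurableSet.univ, Measure.restrict_univ,
    ← ofReal_integral_eq_lintegral_ofReal hp.1 hp.2.1, hp.2.2, ENNReal.ofReal_one]

/-- If the entropy of `p` is finite and `log q` is integrable against `p`, the divergence is the
difference of these integrals. -/
theorem KL_eq (hp : IsProbDensity p) (hq : IsProbDensity q) (hq0 : ∀ᵐ x, 0 < q x)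
    (hent : FiniteEntropy p) (hint : Integrable fun x => p x * Real.log (q x)) :
    KL p q ≠ ⊤ ∧ (KL p q).toReal = -Ent p - ∫ x, p x * Real.log (q x) := by
  have hpm : AEMeasurable (fun x => ENNReal.ofReal (p x)) :=
    hp.1.1.aemeasurable.ennreal_ofReal
  have hqm : AEMeasurable (fun x => ENNReal.ofReal (q x)) :=
    hq.1.1.aemeasurable.ennreal_ofReal
  have hdm : AEMeasurable (fun x => ENNReal.ofReal (p x / q x)) :=
    (hp.1.1.aemeasurable.div hq.1.1.aemeasurable).ennreal_ofReal
  have := hp.isProbabilityMeasure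
  have := hq.isProbabilityMeasure
  have hpv : densityMeasure p ≪ volume := withDensity_absolutelyContinuous _ _
  have hqv : densityMeasure q ≪ volume := withDensity_absolutelyContinuous _ _
  have heq : densityMeasure p
      = (densityMeasure q).withDensity fun x => ENNReal.ofReal (p x / q x) := by
    rw [densityMeasure, densityMeasure, ← withDensity_mul₀ hqm hdm]
    refine withDensity_congr_ae ?_
    filter_upwards [hq0] with x hx
    rw [Pi.mul_apply, ← ENNReal.ofReal_mul hx.le, mul_div_cancel₀ _ hx.ne']
  have hac : densityMeasure p ≪ densityMeasure q := by
    rw [heq]; exact withDensity_absolutelyContinuous _ _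
  have hllr : llr (densityMeasure p) (densityMeasure q)
      =ᵐ[densityMeasure p] fun x => Real.log (p x / q x) := by
    have h1 : (densityMeasure p).rnDeriv (densityMeasure q)
        =ᵐ[densityMeasure p] fun x => ENNReal.ofReal (p x / q x) := by
      refine hac.ae_eq ?_
      conv_lhs => rw [heq]
      exact Measure.rnDeriv_withDensity₀ _ (hdm.mono_ac hqv)
    filter_upwards [h1, hpv.ae_le hq0, hpv.ae_le hp.2.1] with x h1 h2 h3
    rw [llr, h1, ENNReal.toReal_ofReal (div_nonneg h3 h2.le)]
  have hpt : (fun x => (ENNReal.ofReal (p x)).toReal • Real.log (p x / q x))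
      =ᵐ[volume] fun x => -Real.negMulLog (p x) - p x * Real.log (q x) := by
    filter_upwards [hq0, hp.2.1] with x h1 h2
    rw [ENNReal.toReal_ofReal h2, smul_eq_mul, Real.negMulLog]
    -- where `p` vanishes, both sides are `0`
    rcases eq_or_lt_of_le h2 with h | h
    · rw [← h]; simp
    · rw [Real.log_div h.ne' h1.ne']; ring
  have hfin : ∀ᵐ x, ENNReal.ofReal (p x) < ⊤ := ae_of_all _ fun x => ENNReal.ofReal_lt_top
  have hneg : Integrable fun x => -Real.negMulLog (p x) := hent.neg
  have hdiff : Integrable fun x => -Real.negMulLog (p x) - p x * Real.log (q x) :=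
    hneg.sub hint
  have hllr_int : Integrable (llr (densityMeasure p) (densityMeasure q)) (densityMeasure p) := by
    rw [integrable_congr hllr, densityMeasure, integrable_withDensity_iff_integrable_smul₀' hpm hfin,
      integrable_congr hpt]
    exact hdiff
  refine ⟨klDiv_ne_top hac hllr_int, ?_⟩
  rw [KL, toReal_klDiv_of_measure_eq hac (by simp), integral_congr_ae hllr, densityMeasure,
    integral_withDensity_eq_integral_toReal_smul₀ hpm hfin, integral_congr_ae hpt,
    integral_sub hneg hint, integral_neg, Ent]

end Divergence
/-! ### Solutions -/

section Solution

variable {N : ℕ} {T : 𝓢'(Sp N, ℂ)} {a : Sp N → ℝ} {p : Sp N → ℝ}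

theorem IsGivenBy.sub_const (hT : IsGivenBy T a) (c : ℝ) :
    IsGivenBy (T - (c : ℂ) • (volume : Measure (Sp N)).toTemperedDistribution)
      fun x => a x - c := by
  refine ⟨hT.1.sub (locallyIntegrable_const c), fun φ hφ => ?_⟩
  have haC : LocallyIntegrable fun x => (a x : ℂ) := fun x => by
    obtain ⟨u, hu, hau⟩ := hT.1 x
    exact ⟨u, hu, Integrable.ofReal hau⟩
  have h1 : Integrable fun x => φ x * (a x : ℂ) :=
    haC.integrable_smul_left_of_hasCompactSupport φ.continuous hφ
  have h2 : (T - (c : ℂ) • (volume : Measure (Sp N)).toTemperedDistribution) φ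
      = T φ - c * ∫ x, φ x := by simp
  rw [h2, hT.2 φ hφ, ← integral_const_mul, ← integral_sub h1 (φ.integrable.const_mul _)]
  congr 1; ext x; push_cast; ring

theorem IsGivenBy.congr {a' : Sp N → ℝ} (hT : IsGivenBy T a) (h : a =ᵐ[volume] a') :
    IsGivenBy T a' := by
  refine ⟨fun x => ?_, fun φ hφ => ?_⟩
  · obtain ⟨u, hu, hau⟩ := hT.1 x
    exact ⟨u, hu, hau.congr (ae_restrict_of_ae h)⟩
  · rw [hT.2 φ hφ]
    refine integral_congr_ae ?_
    filter_upwards [h] with x hx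
    rw [hx]

theorem FiniteEntropy.translate (h : FiniteEntropy p) (y : Sp N) :
    FiniteEntropy fun x => p (x - y) :=
  Integrable.comp_sub_right h y

theorem Ent_translate (p : Sp N → ℝ) (y : Sp N) : (Ent fun x => p (x - y)) = Ent p :=
  integral_sub_right_eq_self (fun x => Real.negMulLog (p x)) y

theorem nonneg_of_isProbDensity (hp : IsProbDensity p) (hpc : Continuous p) (x : Sp N) :
    0 ≤ p x := by
  have h : (fun x => |p x|) =ᵐ[volume] p := by
    filter_upwards [hp.2.1] with x hx using abs_of_nonneg hx
  rw [← congrFun ((Continuous.ae_eq_iff_eq _ hpc.abs hpc).1 h) x]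
  exact abs_nonneg _

/-- The penalty equation at one parameter, written without the divergence: if `log α = a + K`,
the constant `K` cancels. -/
theorem eq_KL_add_iff {b : 𝓢(Sp N, ℝ)} {α : Sp N → ℝ} {K s : ℝ} {y : Sp N}
    (hT : IsGivenBy T a) (ha : Integrable fun x => Real.exp (a x))
    (hb : ∀ x, 0 ≤ b x) (hby : IsProbDensity fun x => b (x - y)) (hent : FiniteEntropy b)
    (hα : IsProbDensity α) (hα0 : ∀ᵐ x, 0 < α x) (hαa : ∀ᵐ x, Real.log (α x) = a x + K) :
    (s : EReal) = (KL (fun x => b (x - y)) α : EReal) + (K : EReal) ↔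
      s = -Ent b - ∫ x, b (x - y) * a x := by
  have hint := integrable_translate_mul hT ha hb y
  have hlog : (fun x => b (x - y) * Real.log (α x))
      =ᵐ[volume] fun x => b (x - y) * a x + b (x - y) * K := by
    filter_upwards [hαa] with x hx
    rw [hx, mul_add]
  obtain ⟨h1, h2⟩ := KL_eq hby hα hα0 (hent.translate y)
    ((hint.add (hby.1.mul_const K)).congr hlog.symm)
  rw [Ent_translate, integral_congr_ae hlog, integral_add hint (hby.1.mul_const K),
    integral_mul_const, hby.2.2, one_mul] at h2
  rw [← EReal.coe_ennreal_toReal h1, ← EReal.coe_add, EReal.coe_eq_coe_iff, h2]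
  constructor <;> intro h <;> linarith

end Solution
end PenaltyPrior

open MeasureTheory PenaltyPrior

theorem theorem1 {N : ℕ} {ι : Type*} [Nonempty ι]
    (β : EuclideanSpace ℝ (Fin N) → ι → EuclideanSpace ℝ (Fin N) → ℝ)
    (r : EuclideanSpace ℝ (Fin N) → ι → ℝ)
    (R : ι → 𝓢'(EuclideanSpace ℝ (Fin N), ℂ))
    -- a translation-invariant family of probability densities
    (hβ : ∀ μ ν, PenaltyPrior.IsProbDensity (β μ ν))
    (hinv : PenaltyPrior.TranslationInvariant β)
    -- with finite entropy, in the Schwartz class, with nowhere vanishing Fourier transform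
    (hent : ∀ ν, PenaltyPrior.FiniteEntropy (β 0 ν))
    (hSchwartz : ∀ ν, ∃ b : 𝓢(EuclideanSpace ℝ (Fin N), ℝ), ⇑b = β 0 ν)
    (hne : ∀ ν ξ, 𝓕 (fun x => (β 0 ν x : ℂ)) ξ ≠ 0)
    -- the penalty `r_ν` is a continuous function, and, as a distribution, it is tempered with
    -- compactly supported Fourier transform
    (hcont : ∀ ν, Continuous fun μ => r μ ν)
    (hR : ∀ ν, PenaltyPrior.IsGivenBy (R ν) fun μ => r μ ν)
    (hcompact : ∀ ν, IsCompact (Distribution.dsupport (𝓕 (R ν) : 𝓢'(EuclideanSpace ℝ (Fin N), ℂ))))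
    (α : EuclideanSpace ℝ (Fin N) → ℝ) :
    (PenaltyPrior.IsProbDensity α ∧ PenaltyPrior.LogTempered α ∧ PenaltyPrior.IsSolution β r α) ↔
      ∃ a : EuclideanSpace ℝ (Fin N) → ℝ,
        PenaltyPrior.ConditionC (fun ν => PenaltyPrior.logPrior (β 0 ν) (R ν)) a ∧
        α =ᵐ[MeasureTheory.volume] fun θ => Real.exp (a θ) / ∫ x, Real.exp (a x) := by
  choose b hb using hSchwartz
  have hβb : ∀ μ ν, β μ ν = fun x => b ν (x - μ) := fun μ ν => by
    ext x; rw [hb ν, hinv μ ν x]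
  have hby : ∀ ν y, IsProbDensity fun x => b ν (x - y) := fun ν y => hβb y ν ▸ hβ y ν
  simp only [← hb] at hent hne ⊢
  have hbp : ∀ ν, IsProbDensity (b ν) := fun ν => hb ν ▸ hβ 0 ν
  have hb0 : ∀ ν x, 0 ≤ b ν x := fun ν => nonneg_of_isProbDensity (hbp ν) (b ν).continuous
  have hprior : ∀ {T : 𝓢'(Sp N, ℂ)} {a : Sp N → ℝ}, IsGivenBy T a →
      (Integrable fun x => Real.exp (a x)) → ∀ ν, logPrior (b ν) (R ν) = T ↔
        ∀ y, r y ν = -Ent (b ν) - ∫ x, b ν (x - y) * a x := fun hT ha ν =>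
    logPrior_eq_iff_integral (hb0 ν) (hbp ν).2.2 (hne ν) (hcont ν) (hR ν) (hcompact ν) hT ha
  constructor
  · rintro ⟨hα, ⟨hα0, T, hT⟩, K, hK⟩
    have hT' := hT.sub_const K
    have hexp : (fun x => Real.exp (Real.log (α x) - K))
        =ᵐ[volume] fun x => α x * Real.exp (-K) := by
      filter_upwards [hα0] with x hx
      rw [sub_eq_add_neg, Real.exp_add, Real.exp_log hx]
    have hint : Integrable fun x => Real.exp (Real.log (α x) - K) :=
      (hα.1.mul_const _).congr hexp.symm
    refine ⟨fun x => Real.log (α x) - K, ⟨_, fun ν => ?_, hT', hint⟩, ?_⟩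
    · refine (hprior hT' hint ν).2 fun y => ?_
      refine (eq_KL_add_iff (K := K) hT' hint (hb0 ν) (hby ν y) (hent ν) hα hα0
        (ae_of_all _ fun x => by ring)).1 ?_
      rw [← hβb]; exact hK y ν
    · rw [integral_congr_ae hexp, integral_mul_const, hα.2.2, one_mul]
      filter_upwards [hexp] with x hx
      rw [hx, mul_div_cancel_right₀ _ (Real.exp_ne_zero _)]
  · rintro ⟨a, ⟨T, hAT, hT, hexp⟩, hαa⟩
    have hκ : 0 < ∫ x, Real.exp (a x) := integral_exp_pos hexp
    set κ := ∫ x, Real.exp (a x) with hκdef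
    have hα0 : ∀ᵐ x, 0 < α x := by
      filter_upwards [hαa] with x hx
      rw [hx]; positivity
    have hlog : ∀ᵐ x, Real.log (α x) = a x + -Real.log κ := by
      filter_upwards [hαa] with x hx
      rw [hx, Real.log_div (Real.exp_ne_zero _) hκ.ne', Real.log_exp, sub_eq_add_neg]
    have hα : IsProbDensity α := by
      refine ⟨(hexp.div_const κ).congr hαa.symm, hα0.mono fun x hx => hx.le, ?_⟩
      rw [integral_congr_ae hαa, integral_div, ← hκdef, div_self hκ.ne']
    refine ⟨hα, ⟨hα0, _, (hT.sub_const (Real.log κ)).congr ?_⟩, -Real.log κ, fun y ν => ?_⟩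
    · filter_upwards [hlog] with x hx
      rw [hx, sub_eq_add_neg]
    · rw [hβb]
      exact (eq_KL_add_iff hT hexp (hb0 ν) (hby ν y) (hent ν) hα hα0 hlog).2
        ((hprior hT hexp ν).1 (hAT ν) y)
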